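/- Let $\mathsf{XMod}$ be the category of crossed modules of groups: objects are group homomorphisms $\partial\colon X_1\to X_2$ with an action of $X_2$ on $X_1$ by group automorphisms such that $\partial({}^{b}x)=b\,\partial(x)\,b^{-1}$ and ${}^{\partial(x)}y=xyx^{-1}$; morphisms are pairs of group homomorphisms commuting with the connecting morphisms and the actions. A localization functor on $\mathsf{XMod}$ is a functor $\mathsf L\colon\mathsf{XMod}\to\mathsf{XMod}$ with a natural transformation $\ell\colon \mathrm{Id}\to \mathsf L$ such that $\ell^{\mathsf{LX}}$ and $\mathsf L\ell^{\mathsf X}$ are isomorphisms for every $\mathsf X$. A crossed module $\mathsf T$ is $\mathsf L$-local if $\ell^{\mathsf T}$ is an isomorphism, and a morphism $g$ is an $\mathsf L$-equivalence if $\mathsf Lg$ is an isomorphism. For a crossed module $\mathsf A$ let $f\colon \mathsf A\to 1$ be the morphism to the trivial crossed module. Call $\mathsf T$ $\mathsf A$-null if $\mathrm{Hom}(f,\mathsf T)\colon \mathrm{Hom}(1,\mathsf T)\to \mathrm{Hom}(\mathsf A,\mathsf T)$ is a bijection, and call a morphism $g$ an $\mathsf{L}_f$-equivalence if $\mathrm{Hom}(g,\mathsf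 T)$ is a bijection for every $\mathsf A$-null $\mathsf T$. A nullification functor $\mathsf P_{\mathsf A}$ is a localization functor whose local objects are exactly the $\mathsf A$-null crossed modules and whose equivalences are exactly the $\mathsf{L}_f$-equivalences. **Proposition.** For every crossed module $\mathsf A$, the nullification functor $\mathsf P_{\mathsf A}$ exists and is a regular-epi localization: for every choice of a nullification functor $\mathsf P_{\mathsf A}$ and every crossed module $\mathsf T$, the coaugmentation $\ell^{\mathsf T}\colon\mathsf T\to \mathsf P_{\mathsf A}\mathsf T$ is a regular epimorphism in $\mathsf{XMod}$ (a coequalizer of a pair of parallel morphisms), and both of its components $T_1\to(\mathsf P_{\mathsf A}\mathsf T)_1$ and $T_2\to(\mathsf P_{\mathsf A}\mathsf T)_2$ are surjective. -/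

import Mathlib

open CategoryTheory

universe u v

/-- A crossed module of groups `∂ : X₁ → X₂`, with an action of `X₂` on `X₁` by group
automorphisms, written `b • x` for `ᵇx`. -/
structure XMod : Type (u + 1) where
  /-- the group at level one -/
  X₁ : Type u
  /-- the group at level two -/
  X₂ : Type u
  [group₁ : Group X₁]
  [group₂ : Group X₂]
  /-- the connecting morphism -/
  bdry : X₁ →* X₂
  [action : MulDistribMulAction X₂ X₁]
  bdry_smul : ∀ (b : X₂) (x : X₁), bdry (b • x) = b * bdry x * b⁻¹
  peiffer : ∀ x y : X₁, bdry x • y = x * y * x⁻¹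

namespace XMod

attribute [instance] XMod.group₁ XMod.group₂ XMod.action

/-- A morphism of crossed modules: a pair of group homomorphisms which commutes with the
connecting morphisms and with the actions. -/
@[ext]
structure Hom (N M : XMod.{u}) : Type u where
  /-- the component at level one -/
  f₁ : N.X₁ →* M.X₁
  /-- the component at level two -/
  f₂ : N.X₂ →* M.X₂
  comm_bdry : ∀ x : N.X₁, M.bdry (f₁ x) = f₂ (N.bdry x)
  comm_smul : ∀ (b : N.X₂) (x : N.X₁), f₁ (b • x) = f₂ b • f₁ x

/-- The category of crossed modules of groups; composition is componentwise. -/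
instance : Category XMod.{u} where
  Hom := Hom
  id N :=
    { f₁ := MonoidHom.id N.X₁
      f₂ := MonoidHom.id N.X₂
      comm_bdry := fun _ => rfl
      comm_smul := fun _ _ => rfl }
  comp f g :=
    { f₁ := g.f₁.comp f.f₁
      f₂ := g.f₂.comp f.f₂
      comm_bdry := fun x => by simp [f.comm_bdry, g.comm_bdry]
      comm_smul := fun b x => by simp [f.comm_smul, g.comm_smul] }

/-- The trivial crossed module `1`. -/
def one : XMod.{u} where
  X₁ := PUnit
  X₂ := PUnit
  bdry := 1
  action :=
    { smul := fun _ x => x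
      one_smul := fun _ => rfl
      mul_smul := fun _ _ _ => rfl
      smul_mul := fun _ _ _ => rfl
      smul_one := fun _ => rfl }
  bdry_smul := fun _ _ => rfl
  peiffer := fun _ _ => rfl

/-- The unique morphism `A ⟶ 1`. -/
def toOne (A : XMod.{u}) : A ⟶ one.{u} where
  f₁ := 1
  f₂ := 1
  comm_bdry := fun _ => rfl
  comm_smul := fun _ _ => rfl

end XMod

/-- A coaugmented endofunctor `ℓ : Id ⟶ L` of a category. -/
structure CoaugmentedFunctor (C : Type u) [Category.{v} C] where
  /-- the underlying functor -/
  L : C ⥤ C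
  /-- the coaugmentation -/
  coaug : 𝟭 C ⟶ L

namespace CoaugmentedFunctor

variable {C : Type u} [Category.{v} C]

/-- A localization functor: a coaugmented functor which is idempotent, that is, both `ℓ^{LX}`
and `L ℓ^X` are isomorphisms for every `X`. -/
structure IsLocalizationFunctor (P : CoaugmentedFunctor C) : Prop where
  isIso_coaug_obj : ∀ X : C, IsIso (P.coaug.app (P.L.obj X))
  isIso_map_coaug : ∀ X : C, IsIso (P.L.map (P.coaug.app X))

/-- `T` is `L`-local if its coaugmentation is an isomorphism. -/
def IsLocalObject (P : CoaugmentedFunctor C) (T : C) : Prop :=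
  IsIso (P.coaug.app T)

/-- `g` is an `L`-equivalence if `L g` is an isomorphism. -/
def IsEquivalence (P : CoaugmentedFunctor C) {N M : C} (g : N ⟶ M) : Prop :=
  IsIso (P.L.map g)

/-- A regular-epi localization: a localization functor all of whose coaugmentation morphisms
`ℓ^T : T ⟶ L T` are regular epimorphisms. -/
structure IsRegularEpiLocalization (P : CoaugmentedFunctor C) : Prop
    extends IsLocalizationFunctor P where
  isRegularEpi_coaug : ∀ T : C, IsRegularEpi (P.coaug.app T)

end CoaugmentedFunctor

/-- `T` is `L_f`-local: precomposition with `f : A ⟶ B` is a bijection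
`Hom(B, T) → Hom(A, T)`. -/
def IsLfLocal {C : Type u} [Category.{v} C] {A B : C} (f : A ⟶ B) (T : C) : Prop :=
  Function.Bijective (fun h : B ⟶ T => f ≫ h)

/-- `g : N ⟶ M` is an `L_f`-equivalence: precomposition with `g` is a bijection
`Hom(M, T) → Hom(N, T)` for every `L_f`-local `T`. -/
def IsLfEquivalence {C : Type u} [Category.{v} C] {A B : C} (f : A ⟶ B)
    {N M : C} (g : N ⟶ M) : Prop :=
  ∀ T : C, IsLfLocal f T → Function.Bijective (fun h : M ⟶ T => g ≫ h)

/-- `P` is the localization functor `L_f` (which is determined up to a unique isomorphism):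
it is a localization functor whose local objects are the `L_f`-local objects and whose
equivalences are the `L_f`-equivalences. -/
structure IsLocalizationAt {C : Type u} [Category.{v} C] {A B : C} (f : A ⟶ B)
    (P : CoaugmentedFunctor C) : Prop extends P.IsLocalizationFunctor where
  isLocalObject_iff : ∀ T : C, P.IsLocalObject T ↔ IsLfLocal f T
  isEquivalence_iff : ∀ {N M : C} (g : N ⟶ M), P.IsEquivalence g ↔ IsLfEquivalence f g

/-- `P` is the nullification functor `P_A`, that is, `L_f` for `f : A ⟶ 1`. -/
def IsNullification (A : XMod.{u}) (P : CoaugmentedFunctor XMod.{u}) : Prop :=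
  IsLocalizationAt (XMod.toOne A) P

/-! Nullity means that the only morphism from `A` is the trivial one, so it passes to products and
subobjects. A crossed module `T` therefore has a largest null quotient: divide by the intersection
of all normal crossed submodules with null quotient (`nullRadical`). This quotient embeds in the
product of the null ones, hence is null; and a morphism from `T` to a null object has null image, so
its kernel contains the radical and it factors uniquely through the quotient. The projections are
thus reflections onto null objects, and `exists_isLocalizationAt` assembles them into a functor.

For an arbitrary nullification, the coaugmentation is an equivalence to a null object, so it agrees
with the projection up to isomorphism and is componentwise surjective. Such a morphism is the
coequalizer of its kernel pair. -/

section Reflection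

variable {C : Type u} [Category.{v} C] {A B : C} {f : A ⟶ B}

/-- Being `L_f`-local is invariant under isomorphism. -/
theorem IsLfLocal.of_iso {S T : C} (e : S ≅ T) (hS : IsLfLocal f S) : IsLfLocal f T := by
  refine ⟨fun a b hab => ?_, fun k => ?_⟩
  · have h : a ≫ e.inv = b ≫ e.inv := hS.1 (by simpa using hab =≫ e.inv)
    simpa using h
  · obtain ⟨h, hh⟩ := hS.2 (k ≫ e.inv)
    refine ⟨h ≫ e.hom, ?_⟩
    simpa using hh =≫ e.hom

theorem IsLfEquivalence.of_isIso {N M : C} (g : N ⟶ M) [IsIso g] : IsLfEquivalence f g := by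
  refine fun T _ => ⟨fun a b hab => (cancel_epi g).1 hab, fun k => ⟨inv g ≫ k, by simp⟩⟩

theorem IsLfEquivalence.comp {N M K : C} {g : N ⟶ M} {h : M ⟶ K} (hg : IsLfEquivalence f g)
    (hh : IsLfEquivalence f h) : IsLfEquivalence f (g ≫ h) := by
  intro T hT
  simpa [Function.comp_def] using (hg T hT).comp (hh T hT)

theorem IsLfEquivalence.of_comp_left {N M K : C} {g : N ⟶ M} {h : M ⟶ K}
    (hg : IsLfEquivalence f g) (hgh : IsLfEquivalence f (g ≫ h)) : IsLfEquivalence f h := by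
  intro T hT
  refine (Function.Bijective.of_comp_iff' (hg T hT) _).1 ?_
  simpa [Function.comp_def] using hgh T hT

theorem IsLfEquivalence.of_comp_right {N M K : C} {g : N ⟶ M} {h : M ⟶ K}
    (hh : IsLfEquivalence f h) (hgh : IsLfEquivalence f (g ≫ h)) : IsLfEquivalence f g := by
  intro T hT
  refine (Function.Bijective.of_comp_iff _ (hh T hT)).1 ?_
  simpa [Function.comp_def] using hgh T hT

/-- An `L_f`-equivalence between `L_f`-local objects is an isomorphism. -/
theorem IsLfEquivalence.isIso {N M : C} {g : N ⟶ M} (hg : IsLfEquivalence f g)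
    (hN : IsLfLocal f N) (hM : IsLfLocal f M) : IsIso g := by
  obtain ⟨h, hh⟩ := (hg N hN).2 (𝟙 N)
  exact ⟨h, hh, (hg M hM).1 (by simpa using hh =≫ g)⟩

/-- If every object has an `L_f`-equivalence to an `L_f`-local object, then the localization
functor `L_f` exists. -/
theorem exists_isLocalizationAt (Q : C → C) (q : ∀ T, T ⟶ Q T)
    (hQ : ∀ T, IsLfLocal f (Q T)) (hq : ∀ T, IsLfEquivalence f (q T)) :
    ∃ P : CoaugmentedFunctor C, IsLocalizationAt f P := by
  -- `F g` is the unique filler of the naturality square of `q`; uniqueness also yields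
  -- functoriality.
  choose F hF using fun {N M : C} (g : N ⟶ M) => (hq N (Q M) (hQ M)).2 (g ≫ q M)
  dsimp only at hF
  let P : CoaugmentedFunctor C :=
    { L :=
        { obj := Q
          map := F
          map_id := fun T => (hq T _ (hQ T)).1 (by simp [hF])
          map_comp := fun {X Y Z} g h => (hq X _ (hQ Z)).1 (by
            dsimp only
            rw [hF, ← Category.assoc (q X), hF, Category.assoc, Category.assoc, hF]) }
      coaug :=
        { app := q
          naturality := fun _ _ g => (hF g).symm } }
  -- Two-out-of-three in the square `q N ≫ F g = g ≫ q M`, whose `q` sides are equivalences.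
  have heq {N M : C} (g : N ⟶ M) : IsIso (F g) ↔ IsLfEquivalence f g := by
    constructor
    · intro _
      have h : IsLfEquivalence f (g ≫ q M) :=
        hF g ▸ (hq N).comp (IsLfEquivalence.of_isIso (F g))
      exact (hq M).of_comp_right h
    · intro hg
      have h : IsLfEquivalence f (q N ≫ F g) := (hF g).symm ▸ hg.comp (hq M)
      exact ((hq N).of_comp_left h).isIso (hQ N) (hQ M)
  refine ⟨P, ⟨⟨fun X => (hq _).isIso (hQ _) (hQ _), fun X => (heq _).2 (hq X)⟩, fun T => ?_, heq⟩⟩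
  refine ⟨fun h => ?_, fun hT => (hq T).isIso hT (hQ T)⟩
  have : IsIso (q T) := h
  exact (hQ T).of_iso (asIso (q T)).symm

end Reflection

/-! ### Crossed modules: null objects and surjective morphisms -/

namespace XMod

@[ext]
theorem hom_ext {N M : XMod.{u}} {g h : N ⟶ M} (h₁ : ∀ x, g.f₁ x = h.f₁ x)
    (h₂ : ∀ x, g.f₂ x = h.f₂ x) : g = h :=
  Hom.ext (MonoidHom.ext h₁) (MonoidHom.ext h₂)

@[simp]
theorem comp_f₁ {N M K : XMod.{u}} (g : N ⟶ M) (h : M ⟶ K) (x : N.X₁) :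
    (g ≫ h).f₁ x = h.f₁ (g.f₁ x) := rfl

@[simp]
theorem comp_f₂ {N M K : XMod.{u}} (g : N ⟶ M) (h : M ⟶ K) (x : N.X₂) :
    (g ≫ h).f₂ x = h.f₂ (g.f₂ x) := rfl

@[simp]
theorem id_f₁ (N : XMod.{u}) (x : N.X₁) : Hom.f₁ (𝟙 N) x = x := rfl

@[simp]
theorem id_f₂ (N : XMod.{u}) (x : N.X₂) : Hom.f₂ (𝟙 N) x = x := rfl

/-- The unique morphism `1 ⟶ T`. -/
def fromOne (T : XMod.{u}) : one.{u} ⟶ T where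
  f₁ := 1
  f₂ := 1
  comm_bdry := fun _ => map_one _
  comm_smul := fun _ _ => (smul_one _).symm

instance (T : XMod.{u}) : Subsingleton (one.{u} ⟶ T) where
  allEq g h := hom_ext (fun _ => (map_one g.f₁).trans (map_one h.f₁).symm)
    (fun _ => (map_one g.f₂).trans (map_one h.f₂).symm)

/-- `T` is `A`-null exactly when there is only one morphism `A ⟶ T`. -/
theorem isLfLocal_toOne_iff {A T : XMod.{u}} :
    IsLfLocal (toOne A) T ↔ Subsingleton (A ⟶ T) := by
  refine ⟨fun h => ⟨fun a b => ?_⟩, fun h => ⟨fun a b _ => Subsingleton.elim a b, fun k => ?_⟩⟩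
  · obtain ⟨a, rfl⟩ := h.2 a
    obtain ⟨b, rfl⟩ := h.2 b
    rw [Subsingleton.elim a b]
  · exact ⟨fromOne T, Subsingleton.elim _ _⟩

/-- A componentwise surjective morphism is a quotient map: morphisms which kill its kernel
factor uniquely through it. -/
theorem existsUnique_factor {T S Z : XMod.{u}} (q : T ⟶ S) (h₁ : Function.Surjective q.f₁)
    (h₂ : Function.Surjective q.f₂) (k : T ⟶ Z) (k₁ : q.f₁.ker ≤ k.f₁.ker)
    (k₂ : q.f₂.ker ≤ k.f₂.ker) : ∃! h : S ⟶ Z, q ≫ h = k := by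
  let g₁ : S.X₁ →* Z.X₁ := q.f₁.liftOfSurjective h₁ ⟨k.f₁, k₁⟩
  let g₂ : S.X₂ →* Z.X₂ := q.f₂.liftOfSurjective h₂ ⟨k.f₂, k₂⟩
  have e₁ (x) : g₁ (q.f₁ x) = k.f₁ x := q.f₁.liftOfRightInverse_comp_apply _ _ ⟨k.f₁, k₁⟩ x
  have e₂ (x) : g₂ (q.f₂ x) = k.f₂ x := q.f₂.liftOfRightInverse_comp_apply _ _ ⟨k.f₂, k₂⟩ x
  refine ⟨⟨g₁, g₂, fun y => ?_, fun b y => ?_⟩, hom_ext e₁ e₂, fun h hh => ?_⟩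
  · obtain ⟨x, rfl⟩ := h₁ y
    rw [e₁, q.comm_bdry, e₂, k.comm_bdry]
  · obtain ⟨x, rfl⟩ := h₁ y
    obtain ⟨b, rfl⟩ := h₂ b
    rw [← q.comm_smul, e₁, e₁, e₂, k.comm_smul]
  · refine hom_ext (fun y => ?_) (fun y => ?_)
    · obtain ⟨x, rfl⟩ := h₁ y
      rw [← comp_f₁, hh]
      exact (e₁ x).symm
    · obtain ⟨x, rfl⟩ := h₂ y
      rw [← comp_f₂, hh]
      exact (e₂ x).symm

/-! ### Kernel pairs and regular epimorphisms -/

section KernelPair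

variable {T S : XMod.{u}} (g : T ⟶ S)

instance : MulDistribMulAction ((g.f₂.comp (.fst T.X₂ T.X₂)).eqLocus (g.f₂.comp (.snd T.X₂ T.X₂)))
    ((g.f₁.comp (.fst T.X₁ T.X₁)).eqLocus (g.f₁.comp (.snd T.X₁ T.X₁))) where
  smul b x := ⟨(b.1.1 • x.1.1, b.1.2 • x.1.2), by
    have hb : g.f₂ b.1.1 = g.f₂ b.1.2 := b.2
    have hx : g.f₁ x.1.1 = g.f₁ x.1.2 := x.2
    change g.f₁ (b.1.1 • x.1.1) = g.f₁ (b.1.2 • x.1.2)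
    rw [g.comm_smul, g.comm_smul, hb, hx]⟩
  one_smul _ := Subtype.ext (Prod.ext (one_smul _ _) (one_smul _ _))
  mul_smul _ _ _ := Subtype.ext (Prod.ext (mul_smul _ _ _) (mul_smul _ _ _))
  smul_mul _ _ _ := Subtype.ext (Prod.ext (smul_mul' _ _ _) (smul_mul' _ _ _))
  smul_one _ := Subtype.ext (Prod.ext (smul_one _) (smul_one _))

/-- The kernel pair `T ×_S T` of a morphism `g : T ⟶ S`. -/
def kernelPair : XMod.{u} where
  X₁ := (g.f₁.comp (.fst T.X₁ T.X₁)).eqLocus (g.f₁.comp (.snd T.X₁ T.X₁))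
  X₂ := (g.f₂.comp (.fst T.X₂ T.X₂)).eqLocus (g.f₂.comp (.snd T.X₂ T.X₂))
  bdry := ((T.bdry.prodMap T.bdry).comp (Subgroup.subtype _)).codRestrict _ (fun x => by
    have hx : g.f₁ x.1.1 = g.f₁ x.1.2 := x.2
    change g.f₂ (T.bdry x.1.1) = g.f₂ (T.bdry x.1.2)
    rw [← g.comm_bdry, ← g.comm_bdry, hx])
  bdry_smul b x :=
    Subtype.ext (Prod.ext (T.bdry_smul b.1.1 x.1.1) (T.bdry_smul b.1.2 x.1.2))
  peiffer x y := Subtype.ext (Prod.ext (T.peiffer x.1.1 y.1.1) (T.peiffer x.1.2 y.1.2))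

/-- The first projection of the kernel pair. -/
def kernelPairFst : kernelPair g ⟶ T where
  f₁ := (MonoidHom.fst T.X₁ T.X₁).comp (Subgroup.subtype _)
  f₂ := (MonoidHom.fst T.X₂ T.X₂).comp (Subgroup.subtype _)
  comm_bdry := fun _ => rfl
  comm_smul := fun _ _ => rfl

/-- The second projection of the kernel pair. -/
def kernelPairSnd : kernelPair g ⟶ T where
  f₁ := (MonoidHom.snd T.X₁ T.X₁).comp (Subgroup.subtype _)
  f₂ := (MonoidHom.snd T.X₂ T.X₂).comp (Subgroup.subtype _)
  comm_bdry := fun _ => rfl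
  comm_smul := fun _ _ => rfl

/-- A componentwise surjective morphism is the coequalizer of its kernel pair. -/
theorem isRegularEpi_of_surjective (h₁ : Function.Surjective g.f₁)
    (h₂ : Function.Surjective g.f₂) : IsRegularEpi g := by
  have w : kernelPairFst g ≫ g = kernelPairSnd g ≫ g := hom_ext (fun x => x.2) (fun x => x.2)
  refine ⟨⟨⟨kernelPair g, kernelPairFst g, kernelPairSnd g, w, ?_⟩⟩⟩
  refine Limits.Cofork.IsColimit.ofExistsUnique fun s => existsUnique_factor g h₁ h₂ s.π ?_ ?_
  · intro x hx
    -- For `x` in the kernel of `g`, the pair `(x, 1)` lies in the kernel pair, so the cofork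
    -- condition forces `s.π` to kill `x`.
    have hx' : g.f₁ x = g.f₁ 1 := by rw [map_one]; exact hx
    exact (DFunLike.congr_fun (congrArg Hom.f₁ s.condition)
      (⟨(x, 1), hx'⟩ : (kernelPair g).X₁)).trans (map_one s.π.f₁)
  · intro x hx
    have hx' : g.f₂ x = g.f₂ 1 := by rw [map_one]; exact hx
    exact (DFunLike.congr_fun (congrArg Hom.f₂ s.condition)
      (⟨(x, 1), hx'⟩ : (kernelPair g).X₂)).trans (map_one s.π.f₂)

end KernelPair

/-! ### Normal crossed submodules and quotients -/

/-- A normal crossed submodule of `T`. -/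
structure NormalSub (T : XMod.{u}) where
  /-- the subgroup at level one -/
  N₁ : Subgroup T.X₁
  /-- the subgroup at level two -/
  N₂ : Subgroup T.X₂
  normal₂ : N₂.Normal
  bdry_mem : ∀ x ∈ N₁, T.bdry x ∈ N₂
  smul_mem : ∀ (b : T.X₂), ∀ x ∈ N₁, b • x ∈ N₁
  smul_mul_inv_mem : ∀ b ∈ N₂, ∀ x : T.X₁, b • x * x⁻¹ ∈ N₁

namespace NormalSub

variable {T : XMod.{u}}

attribute [instance] normal₂

/-- By the Peiffer identity, conjugation by `y` is the action of `∂y`, which preserves `N₁`. -/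
instance (N : NormalSub T) : N.N₁.Normal where
  conj_mem x hx y := by
    rw [← T.peiffer]
    exact N.smul_mem _ x hx

/-- The kernel of a morphism. -/
def ker {S : XMod.{u}} (g : T ⟶ S) : NormalSub T where
  N₁ := g.f₁.ker
  N₂ := g.f₂.ker
  normal₂ := inferInstance
  bdry_mem x hx := by
    rw [MonoidHom.mem_ker] at hx ⊢
    rw [← g.comm_bdry, hx, map_one]
  smul_mem b x hx := by
    rw [MonoidHom.mem_ker] at hx ⊢
    rw [g.comm_smul, hx, smul_one]
  smul_mul_inv_mem b hb x := by
    rw [MonoidHom.mem_ker] at hb ⊢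
    rw [map_mul, g.comm_smul, hb, one_smul, ← map_mul, mul_inv_cancel, map_one]

/-- The intersection of the normal crossed submodules which satisfy `p`. -/
def inf (p : NormalSub T → Prop) : NormalSub T where
  N₁ := ⨅ (N : NormalSub T) (_ : p N), N.N₁
  N₂ := ⨅ (N : NormalSub T) (_ : p N), N.N₂
  normal₂ := Subgroup.normal_iInf_normal fun _ => Subgroup.normal_iInf_normal fun _ =>
    inferInstance
  bdry_mem x hx := by
    simp only [Subgroup.mem_iInf] at hx ⊢
    exact fun N hN => N.bdry_mem x (hx N hN)
  smul_mem b x hx := by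
    simp only [Subgroup.mem_iInf] at hx ⊢
    exact fun N hN => N.smul_mem b x (hx N hN)
  smul_mul_inv_mem b hb x := by
    simp only [Subgroup.mem_iInf] at hb ⊢
    exact fun N hN => N.smul_mul_inv_mem b (hb N hN) x

variable (N : NormalSub T)

/-- The action of `T.X₂` on the quotient `T.X₁ ⧸ N.N₁`. -/
def toEnd : T.X₂ →* Monoid.End (T.X₁ ⧸ N.N₁) where
  toFun b := QuotientGroup.map N.N₁ N.N₁ (MulDistribMulAction.toMonoidHom T.X₁ b)
    (fun x hx => N.smul_mem b x hx)
  map_one' := by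
    refine MonoidHom.ext fun x => ?_
    induction x using QuotientGroup.induction_on with | H x => ?_
    exact congrArg (QuotientGroup.mk (s := N.N₁)) (one_smul T.X₂ x)
  map_mul' b c := by
    refine MonoidHom.ext fun x => ?_
    induction x using QuotientGroup.induction_on with | H x => ?_
    exact congrArg (QuotientGroup.mk (s := N.N₁)) (mul_smul b c x)

/-- `smul_mul_inv_mem` says exactly that `N₂` acts trivially modulo `N₁`; this lets the action
descend to `T.X₂ ⧸ N.N₂`. -/
theorem le_ker_toEnd : N.N₂ ≤ N.toEnd.ker := by
  intro b hb
  rw [MonoidHom.mem_ker]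
  refine MonoidHom.ext fun x => ?_
  induction x using QuotientGroup.induction_on with | H x => ?_
  change QuotientGroup.mk (s := N.N₁) (b • x) = QuotientGroup.mk x
  rw [eq_comm, QuotientGroup.eq]
  -- Normality turns `b • x * x⁻¹ ∈ N₁` into `x⁻¹ * b • x ∈ N₁`, the form of equality of left
  -- cosets.
  have h := (inferInstance : N.N₁.Normal).mem_comm (N.smul_mul_inv_mem b hb x)
  exact h

instance : MulDistribMulAction (T.X₂ ⧸ N.N₂) (T.X₁ ⧸ N.N₁) where
  smul b x := QuotientGroup.lift N.N₂ N.toEnd N.le_ker_toEnd b x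
  one_smul x := by
    change QuotientGroup.lift N.N₂ N.toEnd N.le_ker_toEnd 1 x = x
    rw [map_one]
    rfl
  mul_smul b c x := by
    change QuotientGroup.lift N.N₂ N.toEnd N.le_ker_toEnd (b * c) x = _
    rw [map_mul]
    rfl
  smul_mul b x y := map_mul (QuotientGroup.lift N.N₂ N.toEnd N.le_ker_toEnd b) x y
  smul_one b := map_one (QuotientGroup.lift N.N₂ N.toEnd N.le_ker_toEnd b)

/-- The quotient of `T` by a normal crossed submodule. -/
def quotient : XMod.{u} where
  X₁ := T.X₁ ⧸ N.N₁
  X₂ := T.X₂ ⧸ N.N₂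
  bdry := QuotientGroup.map N.N₁ N.N₂ T.bdry N.bdry_mem
  bdry_smul b x := by
    induction b using QuotientGroup.induction_on with | H b => ?_
    induction x using QuotientGroup.induction_on with | H x => ?_
    exact congrArg (QuotientGroup.mk (s := N.N₂)) (T.bdry_smul b x)
  peiffer x y := by
    induction x using QuotientGroup.induction_on with | H x => ?_
    induction y using QuotientGroup.induction_on with | H y => ?_
    exact congrArg (QuotientGroup.mk (s := N.N₁)) (T.peiffer x y)

/-- The quotient morphism. -/
def proj : T ⟶ N.quotient where
  f₁ := QuotientGroup.mk' N.N₁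
  f₂ := QuotientGroup.mk' N.N₂
  comm_bdry := fun _ => rfl
  comm_smul := fun _ _ => rfl

theorem proj_f₁_surjective : Function.Surjective N.proj.f₁ := QuotientGroup.mk'_surjective N.N₁

theorem proj_f₂_surjective : Function.Surjective N.proj.f₂ := QuotientGroup.mk'_surjective N.N₂

theorem ker_proj_f₁ : N.proj.f₁.ker = N.N₁ := QuotientGroup.ker_mk' N.N₁

theorem ker_proj_f₂ : N.proj.f₂.ker = N.N₂ := QuotientGroup.ker_mk' N.N₂

/-- The universal property of the quotient. -/
theorem existsUnique_desc {Z : XMod.{u}} (k : T ⟶ Z) (h₁ : N.N₁ ≤ k.f₁.ker)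
    (h₂ : N.N₂ ≤ k.f₂.ker) : ∃! h : N.quotient ⟶ Z, N.proj ≫ h = k :=
  existsUnique_factor N.proj N.proj_f₁_surjective N.proj_f₂_surjective k
    (N.ker_proj_f₁.trans_le h₁) (N.ker_proj_f₂.trans_le h₂)

/-! ### The null radical -/

/-- The smallest normal crossed submodule of `T` with an `A`-null quotient. -/
def nullRadical (A T : XMod.{u}) : NormalSub T :=
  inf fun N => Subsingleton (A ⟶ N.quotient)

theorem nullRadical_le {A : XMod.{u}} {N : NormalSub T} (h : Subsingleton (A ⟶ N.quotient)) :
    (nullRadical A T).N₁ ≤ N.N₁ ∧ (nullRadical A T).N₂ ≤ N.N₂ :=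
  ⟨iInf₂_le N h, iInf₂_le N h⟩

theorem subsingleton_hom_quotient_nullRadical (A T : XMod.{u}) :
    Subsingleton (A ⟶ (nullRadical A T).quotient) := by
  -- the quotient by the intersection embeds into the product of the null quotients
  have key (a b : A ⟶ (nullRadical A T).quotient) (N : NormalSub T)
      (hN : Subsingleton (A ⟶ N.quotient)) :
      ∃ h, (nullRadical A T).proj ≫ h = N.proj ∧ a ≫ h = b ≫ h := by
    obtain ⟨h, hh, -⟩ := (nullRadical A T).existsUnique_desc N.proj
      ((nullRadical_le hN).1.trans_eq N.ker_proj_f₁.symm)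
      ((nullRadical_le hN).2.trans_eq N.ker_proj_f₂.symm)
    exact ⟨h, hh, Subsingleton.elim _ _⟩
  refine ⟨fun a b => hom_ext (fun x => ?_) (fun x => ?_)⟩
  · obtain ⟨y, hy⟩ := proj_f₁_surjective _ (a.f₁ x)
    obtain ⟨z, hz⟩ := proj_f₁_surjective _ (b.f₁ x)
    rw [← hy, ← hz]
    refine (QuotientGroup.eq (s := (nullRadical A T).N₁)).2 ?_
    simp only [nullRadical, inf, Subgroup.mem_iInf]
    intro N hN
    obtain ⟨h, hh, e⟩ := key a b N hN
    refine (QuotientGroup.eq (s := N.N₁)).1 ?_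
    change N.proj.f₁ y = N.proj.f₁ z
    rw [← hh, comp_f₁, comp_f₁, hy, hz, ← comp_f₁, e, comp_f₁]
  · obtain ⟨y, hy⟩ := proj_f₂_surjective _ (a.f₂ x)
    obtain ⟨z, hz⟩ := proj_f₂_surjective _ (b.f₂ x)
    rw [← hy, ← hz]
    refine (QuotientGroup.eq (s := (nullRadical A T).N₂)).2 ?_
    simp only [nullRadical, inf, Subgroup.mem_iInf]
    intro N hN
    obtain ⟨h, hh, e⟩ := key a b N hN
    refine (QuotientGroup.eq (s := N.N₂)).1 ?_
    change N.proj.f₂ y = N.proj.f₂ z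
    rw [← hh, comp_f₂, comp_f₂, hy, hz, ← comp_f₂, e, comp_f₂]

/-- The image `T ⧸ ker g` of a morphism to an `A`-null crossed module is `A`-null. -/
theorem subsingleton_hom_quotient_ker {A S : XMod.{u}} (g : T ⟶ S) (hS : Subsingleton (A ⟶ S)) :
    Subsingleton (A ⟶ (ker g).quotient) := by
  obtain ⟨h, hh, -⟩ := (ker g).existsUnique_desc g le_rfl le_rfl
  -- The induced `h` is a monomorphism into the null `S`, so morphisms from `A` are already equal
  -- once they agree after `h`.
  have inj₁ : Function.Injective h.f₁ := by
    intro y z hyz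
    obtain ⟨y, rfl⟩ := proj_f₁_surjective _ y
    obtain ⟨z, rfl⟩ := proj_f₁_surjective _ z
    rw [← comp_f₁, ← comp_f₁, hh] at hyz
    exact (QuotientGroup.eq (s := (ker g).N₁)).2 (g.f₁.eq_iff.1 hyz.symm)
  have inj₂ : Function.Injective h.f₂ := by
    intro y z hyz
    obtain ⟨y, rfl⟩ := proj_f₂_surjective _ y
    obtain ⟨z, rfl⟩ := proj_f₂_surjective _ z
    rw [← comp_f₂, ← comp_f₂, hh] at hyz
    exact (QuotientGroup.eq (s := (ker g).N₂)).2 (g.f₂.eq_iff.1 hyz.symm)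
  refine ⟨fun a b => ?_⟩
  have e : a ≫ h = b ≫ h := Subsingleton.elim _ _
  exact hom_ext (fun x => inj₁ (by rw [← comp_f₁, e, comp_f₁]))
    (fun x => inj₂ (by rw [← comp_f₂, e, comp_f₂]))

theorem isLfLocal_quotient_nullRadical (A T : XMod.{u}) :
    IsLfLocal (toOne A) (nullRadical A T).quotient :=
  isLfLocal_toOne_iff.2 (subsingleton_hom_quotient_nullRadical A T)

/-- The kernel of a morphism to a null object has null quotient, so it is one of the submodules
intersected in the radical. -/
theorem isLfEquivalence_proj_nullRadical (A T : XMod.{u}) :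
    IsLfEquivalence (toOne A) (nullRadical A T).proj := by
  intro S hS
  rw [Function.bijective_iff_existsUnique]
  intro g
  have h := nullRadical_le (subsingleton_hom_quotient_ker g (isLfLocal_toOne_iff.1 hS))
  exact (nullRadical A T).existsUnique_desc g h.1 h.2

end NormalSub

/-- Every `L_f`-equivalence for `f : A ⟶ 1` with an `A`-null target is componentwise
surjective. -/
theorem surjective_of_isLfEquivalence {A T S : XMod.{u}} (g : T ⟶ S)
    (hg : IsLfEquivalence (toOne A) g) (hS : IsLfLocal (toOne A) S) :
    Function.Surjective g.f₁ ∧ Function.Surjective g.f₂ := by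
  let N := NormalSub.nullRadical A T
  obtain ⟨h, hh⟩ := (NormalSub.isLfEquivalence_proj_nullRadical A T S hS).2 g
  dsimp only at hh
  -- By two-out-of-three `h` is an equivalence, and both its ends are null.
  have : IsIso h :=
    ((NormalSub.isLfEquivalence_proj_nullRadical A T).of_comp_left (hh.symm ▸ hg)).isIso
      (NormalSub.isLfLocal_quotient_nullRadical A T) hS
  have h₁ : Function.Surjective h.f₁ := fun y =>
    ⟨(inv h).f₁ y, by rw [← comp_f₁, IsIso.inv_hom_id, id_f₁]⟩
  have h₂ : Function.Surjective h.f₂ := fun y =>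
    ⟨(inv h).f₂ y, by rw [← comp_f₂, IsIso.inv_hom_id, id_f₂]⟩
  rw [← hh]
  exact ⟨h₁.comp N.proj_f₁_surjective, h₂.comp N.proj_f₂_surjective⟩

end XMod

theorem proposition2p7 (A : XMod.{u}) :
    (∃ P : CoaugmentedFunctor XMod.{u}, IsNullification A P) ∧
    ∀ P : CoaugmentedFunctor XMod.{u}, IsNullification A P →
      P.IsRegularEpiLocalization ∧
      ∀ T : XMod.{u},
        Function.Surjective (P.coaug.app T).f₁ ∧ Function.Surjective (P.coaug.app T).f₂ := by
  refine ⟨exists_isLocalizationAt (fun T => (XMod.NormalSub.nullRadical A T).quotient)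
    (fun T => (XMod.NormalSub.nullRadical A T).proj)
    (XMod.NormalSub.isLfLocal_quotient_nullRadical A)
    (XMod.NormalSub.isLfEquivalence_proj_nullRadical A), fun P hP => ?_⟩
  have surj (T : XMod.{u}) :
      Function.Surjective (P.coaug.app T).f₁ ∧ Function.Surjective (P.coaug.app T).f₂ :=
    -- The two halves of idempotence make `ℓ^T` an equivalence and its target null.
    XMod.surjective_of_isLfEquivalence _
      ((hP.isEquivalence_iff _).1 (hP.isIso_map_coaug T))
      ((hP.isLocalObject_iff _).1 (hP.isIso_coaug_obj T))
  exact ⟨⟨hP.toIsLocalizationFunctor,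
    fun T => XMod.isRegularEpi_of_surjective _ (surj T).1 (surj T).2⟩, surj⟩
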